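/- Setup. Let $\nu$ be a nonzero measure on $\mathbb R^n$, $\sigma>0$, $b(\eta)=\sigma^2\log\int e^{\langle y,\eta\rangle/\sigma^2}\,d\nu(y)$, and assume that $\Omega=\{\eta\in\mathbb R^n: b(\eta)<\infty\}$ is open and nonempty (a regular exponential dispersion family). For $\eta\in\Omega$ let $p_\eta(y)=\exp\{(\langle y,\eta\rangle-b(\eta))/\sigma^2\}$ be the density of the response $y$ with respect to $\nu$, and let $l_0(\eta;y)=\{-\langle y,\eta\rangle+b(\eta)\}/\sigma^2$. Let $X\in\mathbb R^{n\times p}$; under the parameter $\beta^*\in\mathbb R^p$ the response has density $p_{X\beta^*}$. For a function $\psi$ let $$\Delta_\psi(\beta,\gamma)=\psi(\beta)-\psi(\gamma)-\lim_{\epsilon\to0+}\frac{\psi(\gamma+\epsilon(\beta-\gamma))-\psi(\gamma)}{\epsilon},$$ and let $D_2(\beta,\gamma)=\|\beta-\gamma\|_2^2/2$. (The value $\Delta_{l_0}(\eta_1,\eta_2)$ does not depend on $y$.) For $0<M\le+\infty$ put $\mathcal B(s^*,M)=\{\beta\in\mathbb R^p:\|\beta\|_0\le s^*,\ \|\beta\|_\infty\le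 M\}$ and $P(s^*)=s^*\log(ep/s^*)$. Let $I:[0,\infty)\to[0,\infty)$ be any nondecreasing function with $I(0)=0$, $I\not\equiv0$. Theorem. Assume $p\ge2$, $1\le s^*\le p/2$ and $X\beta\in\Omega$ for all $\beta\in\mathcal B(s^*,M)$. (i) If $\kappa>0$ and $\Delta_{l_0}(0,X\beta)\,\sigma^2\le\kappa D_2(0,\beta)$ for all $\beta\in\mathcal B(s^*,M)$, then there exist positive constants $c,\tilde c$, depending on $I$ only, such that $$\inf_{\hat\beta}\ \sup_{\beta^*\in\mathcal B(s^*,M)}\mathbb E\, I\!\left(\frac{D_2(\beta^*,\hat\beta)}{\tilde c\,\min\{\sigma^2P(s^*)/\kappa,\ M^2s^*\}}\right)\ge c,$$ where $\hat\beta$ ranges over all estimators, that is, all measurable functions of $y$ with values in $\mathbb R^p$. (ii) Let $\underline\kappa>0$ and $\overline\kappa\ge0$, where $\overline\kappa=0$ is allowed only if $M<\infty$ (and then $\underline\kappa/\overline\kappa=+\infty$). If $\underline\kappa D_2(\beta_1,\beta_2)\le D_2(X\beta_1,X\beta_2)$ and $\Delta_{l_0}(0,X\beta_1)\,\sigma^2\le\overline\kappa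 D_2(0,\beta_1)$ for all $\beta_1,\beta_2\in\mathcal B(s^*,M)$, then there exist positive constants $c,\tilde c$, depending on $I$ only, such that $$\inf_{\hat\beta}\ \sup_{\beta^*\in\mathcal B(s^*,M)}\mathbb E\, I\!\left(\frac{D_2(X\beta^*,X\hat\beta)}{\tilde c\,\min\{(\underline\kappa/\overline\kappa)\sigma^2P(s^*),\ \underline\kappa M^2s^*\}}\right)\ge c.$$ -/

import Mathlib

open MeasureTheory Filter Topology
open scoped NNReal ENNReal

noncomputable section

namespace SparseGLM

/-- The Euclidean space `ℝ^n`. -/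
abbrev E (n : ℕ) : Type := EuclideanSpace ℝ (Fin n)

/-- One-sided directional derivative
`δψ(β; h) = lim_{ε → 0+} (ψ(β + ε h) - ψ(β)) / ε`. -/
def dirDeriv {n : ℕ} (ψ : E n → ℝ) (β h : E n) : ℝ :=
  limUnder (𝓝[>] (0 : ℝ)) fun ε : ℝ => (ψ (β + ε • h) - ψ β) / ε

/-- Generalized Bregman function `Δ_ψ(β, γ) = ψ(β) - ψ(γ) - δψ(γ; β - γ)`. -/
def gbf {n : ℕ} (ψ : E n → ℝ) (β γ : E n) : ℝ :=
  ψ β - ψ γ - dirDeriv ψ γ (β - γ)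

/-- `D₂(β, γ) = ‖β - γ‖₂² / 2`. -/
def D2 {n : ℕ} (β γ : E n) : ℝ≥0 := ‖β - γ‖₊ ^ 2 / 2

/-- Normalizing integral `∫ exp(⟨y, η⟩ / σ²) dν(y) ∈ [0, ∞]`, where `ν` is the base measure
of the family (the factor `exp(-c(·, σ²))` is absorbed into `ν`). -/
def normalizer {n : ℕ} (ν : Measure (E n)) (σ : ℝ) (η : E n) : ℝ≥0∞ :=
  ∫⁻ y, ENNReal.ofReal (Real.exp (inner ℝ y η / σ ^ 2)) ∂ν

/-- Natural parameter space `Ω = dom b`: the points where the normalizing integral is finite. -/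
def Ω {n : ℕ} (ν : Measure (E n)) (σ : ℝ) : Set (E n) :=
  {η | normalizer ν σ η < ∞}

/-- Cumulant function `b(η) = σ² log ∫ exp(⟨y, η⟩ / σ²) dν(y)` (meaningful for `η ∈ Ω`);
it is the function that makes `exp((⟨y, η⟩ - b(η)) / σ²)` integrate to one. -/
def cumulant {n : ℕ} (ν : Measure (E n)) (σ : ℝ) (η : E n) : ℝ :=
  σ ^ 2 * Real.log (normalizer ν σ η).toReal

/-- Regular exponential dispersion family: nontrivial base measure (so that `b > -∞`),
`σ > 0`, and a nonempty open natural parameter space. -/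
structure IsRegular {n : ℕ} (ν : Measure (E n)) (σ : ℝ) : Prop where
  scale_pos : 0 < σ
  base_ne_zero : ν ≠ 0
  dom_nonempty : (Ω ν σ).Nonempty
  dom_open : IsOpen (Ω ν σ)

/-- The distribution of the response with natural parameter `η`: density
`p_η(y) = exp((⟨y, η⟩ - b(η)) / σ²)` with respect to `ν`. -/
def law {n : ℕ} (ν : Measure (E n)) (σ : ℝ) (η : E n) : Measure (E n) :=
  ν.withDensity fun y => ENNReal.ofReal (Real.exp ((inner ℝ y η - cumulant ν σ η) / σ ^ 2))

/-- Loss `l₀(η; y) = (-⟨y, η⟩ + b(η)) / σ²`. -/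
def loss {n : ℕ} (ν : Measure (E n)) (σ : ℝ) (y η : E n) : ℝ :=
  (-inner ℝ y η + cumulant ν σ η) / σ ^ 2

/-- The systematic component `X β`. -/
def lin {n p : ℕ} (X : Matrix (Fin n) (Fin p) ℝ) (β : E p) : E n :=
  WithLp.toLp 2 (X.mulVec β.ofLp)

/-- The signal class `{β ∈ ℝ^p : ‖β‖₀ ≤ s, ‖β‖_∞ ≤ M}`, with `0 ≤ M ≤ ∞`. -/
def signals (p s : ℕ) (M : ℝ≥0∞) : Set (E p) :=
  {β | (Finset.univ.filter fun j => β j ≠ 0).card ≤ s ∧ ∀ j, ENNReal.ofReal |β j| ≤ M}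

/-- `P(s) = s log(e p / s)`. -/
def P (p s : ℕ) : ℝ := s * Real.log (Real.exp 1 * p / s)

/-- `Δ_{l₀}(0, X β) σ² ≤ κ D₂(0, β)` for all signals `β` of the class, where every `X β` is a
natural parameter. (`Δ_{l₀(·; y)}` does not depend on `y`, as `l₀(·; y)` for two values of `y`
differ by a linear function.) -/
def UpperCond {n p : ℕ} (ν : Measure (E n)) (σ : ℝ) (X : Matrix (Fin n) (Fin p) ℝ) (s : ℕ)
    (M : ℝ≥0∞) (κ : ℝ≥0) : Prop :=
  ∀ β ∈ signals p s M, lin X β ∈ Ω ν σ ∧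
    ∀ y : E n, gbf (loss ν σ y) 0 (lin X β) * σ ^ 2 ≤ κ * D2 0 β

/-- `κ D₂(β₁, β₂) ≤ D₂(X β₁, X β₂)` for all signals `β₁, β₂` of the class. -/
def LowerCond {n p : ℕ} (X : Matrix (Fin n) (Fin p) ℝ) (s : ℕ) (M : ℝ≥0∞) (κ : ℝ≥0) : Prop :=
  ∀ β₁ ∈ signals p s M, ∀ β₂ ∈ signals p s M, κ * D2 β₁ β₂ ≤ D2 (lin X β₁) (lin X β₂)

/-- Minimax risk `inf_{β̂} sup_{β* ∈ B(s, M)} E L(β*, β̂(y))`, where `y` has natural parameter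
`X β*` and `β̂` runs over all estimators, i.e. measurable functions of `y`. -/
def minimaxRisk {n p : ℕ} (ν : Measure (E n)) (σ : ℝ) (X : Matrix (Fin n) (Fin p) ℝ) (s : ℕ)
    (M : ℝ≥0∞) (L : E p → E p → ℝ≥0) : ℝ≥0∞ :=
  ⨅ (est : E n → E p) (_ : Measurable est), ⨆ β ∈ signals p s M,
    ∫⁻ y, (L β (est y) : ℝ≥0∞) ∂(law ν σ (lin X β))

/-- Estimation rate `min{σ² P(s) / κ, M² s}`. -/
def rateEst (p s : ℕ) (σ : ℝ) (M : ℝ≥0∞) (κ : ℝ≥0) : ℝ≥0∞ :=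
  min (ENNReal.ofReal (σ ^ 2 * P p s) / κ) (M ^ 2 * s)

/-- Prediction rate `min{(κ₁ / κ₂) σ² P(s), κ₁ M² s}`
(with `κ₁ / 0 = ∞` for `κ₁ > 0`). -/
def ratePred (p s : ℕ) (σ : ℝ) (M : ℝ≥0∞) (κ₁ κ₂ : ℝ≥0) : ℝ≥0∞ :=
  min ((κ₁ : ℝ≥0∞) / κ₂ * ENNReal.ofReal (σ ^ 2 * P p s)) (κ₁ * M ^ 2 * s)

end SparseGLM

end

namespace SparseGLM

/-! ### Packings: Hamming codes and sparse vectors -/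

section Packing

/-! The bound is a Fano argument. Among the signals of the class one finds finitely many, well
separated and with log-cardinality of order `P p s`, whose response laws are all close in
Kullback–Leibler divergence to the law at `0`. No estimator can identify every one of them, so for
some signal it errs by the separation radius with probability at least `1 / 12`.

Packing (`exists_packing`): `s` blocks of `q = p / s` coordinates are laid out in `Fin p`. A word in
`Fin s → Fin q` selects one coordinate per block, which receives the value `r`. A Gilbert–Varshamov
code (`exists_code`) keeps distinct words at Hamming distance at least `s / 6`, hence distinct
signals at squared distance at least `s * r ^ 2 / 6`.

Information (`integral_logRatio_law`): in an exponential family the divergence from the law at `η`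
to the law at `0` is exactly `gbf (loss ν σ 0) 0 η`, the quantity that `UpperCond` controls.
Choosing `r` small makes it at most a quarter of the log-cardinality. Then `exists_law_real_le`
applies to the disjoint events that the estimator lands near a given signal.

Both claims are instances of `le_minimaxRisk`, with the loss measured through `T = id` or `T = lin
X`. -/

theorem two_sub_inv_pow_three_le_sq {N : ℕ} (hN : 2 ≤ N) :
    (2 - (N : ℝ)⁻¹) ^ 3 ≤ (N : ℝ) ^ 2 := by
  rcases hN.eq_or_lt with rfl | h
  · norm_num
  · have h3 : (3 : ℝ) ≤ N := by exact_mod_cast h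
    have h0 : (0 : ℝ) < (N : ℝ)⁻¹ := by positivity
    have h1 : (N : ℝ)⁻¹ ≤ 1 := inv_le_one_of_one_le₀ (by linarith)
    calc (2 - (N : ℝ)⁻¹) ^ 3 ≤ 2 ^ 3 := by
          apply pow_le_pow_left₀ <;> linarith
      _ ≤ (N : ℝ) ^ 2 := by nlinarith

/-- The exponent `2 / 3` serves twice: `1 / 6 + 2 / 3 < 1` makes Hamming balls small, and `1 / 4 + 2
/ 3 < 1` closes the Fano bound. -/
theorem two_sub_inv_le_rpow {N : ℕ} (hN : 2 ≤ N) :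
    2 - (N : ℝ)⁻¹ ≤ (N : ℝ) ^ (2 / 3 : ℝ) := by
  have h0 : (0 : ℝ) ≤ (N : ℝ) := by positivity
  refine le_of_pow_le_pow_left₀ (n := 3) (by norm_num) (by positivity) ?_
  rw [← Real.rpow_natCast ((N : ℝ) ^ (2 / 3 : ℝ)), ← Real.rpow_mul h0]
  norm_num
  exact two_sub_inv_pow_three_le_sq hN

theorem log_two_sub_inv_le {N : ℕ} (hN : 2 ≤ N) :
    Real.log (2 - (N : ℝ)⁻¹) ≤ 2 / 3 * Real.log N := by
  have h2 : (2 : ℝ) ≤ N := by exact_mod_cast hN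
  have h1 : (N : ℝ)⁻¹ ≤ 1 := inv_le_one_of_one_le₀ (by linarith)
  rw [← Real.log_rpow (by linarith)]
  exact Real.log_le_log (by linarith) (two_sub_inv_le_rpow hN)

/-- The summand is a product over coordinates, and each coordinate has one agreeing letter and `card
α - 1` disagreeing ones. -/
theorem sum_pow_hammingDist {ι α : Type*} [Fintype ι] [Fintype α] [DecidableEq ι]
    [DecidableEq α] (x : ℝ) (f : ι → α) :
    ∑ g : ι → α, x ^ hammingDist f g
      = (1 + ((Fintype.card α : ℝ) - 1) * x) ^ Fintype.card ι := by
  have h1 : ∀ g : ι → α, x ^ hammingDist f g = ∏ i, if f i = g i then 1 else x := by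
    intro g
    rw [Finset.prod_ite, Finset.prod_const_one, Finset.prod_const, one_mul, hammingDist]
  have h2 : ∀ i, ∑ a : α, (if f i = a then 1 else x) = 1 + ((Fintype.card α : ℝ) - 1) * x := by
    intro i
    rw [← Finset.add_sum_erase _ _ (Finset.mem_univ (f i)), if_pos rfl,
      Finset.sum_congr rfl fun a ha => if_neg (Finset.ne_of_mem_erase ha).symm,
      Finset.sum_const, Finset.card_erase_of_mem (Finset.mem_univ _), nsmul_eq_mul,
      Finset.card_univ, Nat.cast_pred (Fintype.card_pos_iff.2 ⟨f i⟩)]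
  simp_rw [h1]
  have h3 := Finset.prod_univ_sum (fun _ : ι => (Finset.univ : Finset α))
    (fun i a => if f i = a then (1 : ℝ) else x)
  rw [Fintype.piFinset_univ] at h3
  rw [← h3, Finset.prod_congr rfl fun i _ => h2 i, Finset.prod_const, Finset.card_univ]

/-- Volume bound for Hamming balls of radius `s / 6`. -/
theorem card_hammingBall_le {s q : ℕ} (hq : 2 ≤ q) (f : Fin s → Fin q) :
    ((Finset.univ.filter fun g : Fin s → Fin q => 6 * hammingDist f g < s).card : ℝ)
      ≤ (q : ℝ) ^ (5 / 6 * s : ℝ) := by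
  have hq0 : (0 : ℝ) < q := by positivity
  have hq1 : (1 : ℝ) ≤ q := by exact_mod_cast (by omega : 1 ≤ q)
  set B := Finset.univ.filter fun g : Fin s → Fin q => 6 * hammingDist f g < s
  have h1 : (B.card : ℝ) ≤ (q : ℝ) ^ (s / 6 : ℝ) * ∑ g : Fin s → Fin q,
      ((q : ℝ)⁻¹) ^ hammingDist f g := by
    calc (B.card : ℝ) = ∑ g ∈ B, (1 : ℝ) := by simp
      -- Chernoff's trick with base `1 / q`: inside the ball the weight is at least `1`, and summed
      -- over all words it factorizes.
      _ ≤ ∑ g ∈ B, (q : ℝ) ^ (s / 6 : ℝ) * ((q : ℝ)⁻¹) ^ hammingDist f g := by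
          refine Finset.sum_le_sum fun g hg => ?_
          have hg' : 6 * hammingDist f g < s := (Finset.mem_filter.1 hg).2
          have hg'' : (6 * hammingDist f g : ℝ) ≤ s := by exact_mod_cast hg'.le
          rw [inv_pow, ← div_eq_mul_inv, one_le_div (by positivity), ← Real.rpow_natCast]
          exact Real.rpow_le_rpow_of_exponent_le hq1 (by linarith)
      _ ≤ ∑ g, (q : ℝ) ^ (s / 6 : ℝ) * ((q : ℝ)⁻¹) ^ hammingDist f g :=
          Finset.sum_le_sum_of_subset_of_nonneg (Finset.subset_univ _)
            fun _ _ _ => by positivity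
      _ = _ := by rw [Finset.mul_sum]
  refine h1.trans ?_
  rw [sum_pow_hammingDist, Fintype.card_fin, Fintype.card_fin]
  have h2 : 1 + ((q : ℝ) - 1) * (q : ℝ)⁻¹ = 2 - (q : ℝ)⁻¹ := by field_simp; ring
  have h3 : 0 ≤ 2 - (q : ℝ)⁻¹ := by
    have := inv_le_one_of_one_le₀ hq1
    linarith
  rw [h2]
  calc (q : ℝ) ^ (s / 6 : ℝ) * (2 - (q : ℝ)⁻¹) ^ s
      ≤ (q : ℝ) ^ (s / 6 : ℝ) * ((q : ℝ) ^ (2 / 3 : ℝ)) ^ s := by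
        gcongr
        exact two_sub_inv_le_rpow hq
    _ = (q : ℝ) ^ (5 / 6 * s : ℝ) := by
        rw [← Real.rpow_natCast, ← Real.rpow_mul hq0.le, ← Real.rpow_add hq0]
        congr 1
        ring

/-- Gilbert–Varshamov bound over an alphabet of size `q`. -/
theorem exists_code {s q : ℕ} (hq : 2 ≤ q) :
    ∃ C : Finset (Fin s → Fin q),
      (∀ f ∈ C, ∀ g ∈ C, f ≠ g → s ≤ 6 * hammingDist f g) ∧
      (q : ℝ) ^ (s / 6 : ℝ) ≤ C.card := by
  classical
  have hq0 : (0 : ℝ) < q := by positivity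
  let S : Finset (Finset (Fin s → Fin q)) := Finset.univ.filter fun C =>
    ∀ f ∈ C, ∀ g ∈ C, f ≠ g → s ≤ 6 * hammingDist f g
  obtain ⟨C, hC, hmax⟩ := S.exists_max_image Finset.card ⟨∅, by simp [S]⟩
  have hC' := (Finset.mem_filter.1 hC).2
  refine ⟨C, hC', ?_⟩
  -- A code of maximal size cannot be enlarged, so every word outside it lies in the ball of some
  -- codeword.
  have hcover : (Finset.univ : Finset (Fin s → Fin q)) ⊆
      C ∪ C.biUnion fun f => Finset.univ.filter fun g => 6 * hammingDist f g < s := by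
    intro g _
    by_contra hg
    simp only [Finset.mem_union, Finset.mem_biUnion, Finset.mem_filter, Finset.mem_univ,
      true_and, not_or, not_exists, not_and, not_lt] at hg
    have hin : insert g C ∈ S := by
      refine Finset.mem_filter.2 ⟨Finset.mem_univ _, ?_⟩
      intro a ha b hb hab
      rcases Finset.mem_insert.1 ha with rfl | ha' <;>
        rcases Finset.mem_insert.1 hb with rfl | hb'
      · exact absurd rfl hab
      · rw [hammingDist_comm]; exact hg.2 b hb'
      · exact hg.2 a ha'
      · exact hC' a ha' b hb' hab
    have := hmax _ hin
    rw [Finset.card_insert_of_notMem hg.1] at this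
    omega
  -- For `s = 0` the strict balls are empty and miss their own centres, so this case is separate.
  rcases Nat.eq_zero_or_pos s with rfl | hs
  · have : 0 < C.card := by
      have h := hmax {fun i => i.elim0} (by
        refine Finset.mem_filter.2 ⟨Finset.mem_univ _, ?_⟩
        intros; omega)
      simpa using h
    simpa using this
  have hcover' : (Finset.univ : Finset (Fin s → Fin q)) ⊆
      C.biUnion fun f => Finset.univ.filter fun g => 6 * hammingDist f g < s := by
    intro g hg
    rcases Finset.mem_union.1 (hcover hg) with h | h
    · exact Finset.mem_biUnion.2 ⟨g, h, by simpa using hs⟩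
    · exact h
  have h1 : (q : ℝ) ^ (s : ℝ) ≤ C.card * (q : ℝ) ^ (5 / 6 * s : ℝ) := by
    have h := (Finset.card_le_card hcover').trans Finset.card_biUnion_le
    rw [Finset.card_univ, Fintype.card_fun, Fintype.card_fin, Fintype.card_fin] at h
    have h' : ((q : ℝ)) ^ s ≤ ∑ f ∈ C,
        ((Finset.univ.filter fun g : Fin s → Fin q => 6 * hammingDist f g < s).card : ℝ) := by
      exact_mod_cast h
    rw [Real.rpow_natCast]
    refine h'.trans ((Finset.sum_le_sum fun f _ => card_hammingBall_le hq f).trans ?_)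
    rw [Finset.sum_const, nsmul_eq_mul]
  have h2 : (q : ℝ) ^ (s : ℝ) = (q : ℝ) ^ (s / 6 : ℝ) * (q : ℝ) ^ (5 / 6 * s : ℝ) := by
    rw [← Real.rpow_add hq0]
    congr 1
    ring
  rw [h2] at h1
  exact le_of_mul_le_mul_right h1 (by positivity)

/-! ### Sparse signals built from codewords -/

theorem P_pos {p s : ℕ} (hs : 1 ≤ s) (hsp : 2 * s ≤ p) : 0 < P p s := by
  have hs0 : (0 : ℝ) < s := by exact_mod_cast hs
  have hsp' : (2 * s : ℝ) ≤ p := by exact_mod_cast hsp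
  refine mul_pos hs0 (Real.log_pos ?_)
  rw [one_lt_div hs0]
  have := Real.add_one_le_exp (1 : ℝ)
  nlinarith

/-- The alphabet size is the integer quotient `p / s`. Rounding down and dropping the factor `e`
cost only a constant, because the quotient is at least `2`. -/
theorem P_le_mul_log_div {p s : ℕ} (hs : 1 ≤ s) (hsp : 2 * s ≤ p) :
    P p s ≤ 4 * (s * Real.log (p / s : ℕ)) := by
  have hq : 2 ≤ p / s := (Nat.le_div_iff_mul_le (by omega)).2 hsp
  have hlt : p < (p / s + 1) * s := by
    rw [Nat.add_mul, one_mul]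
    exact Nat.lt_div_mul_add (by omega)
  generalize p / s = q at *
  have hs0 : (0 : ℝ) < s := by exact_mod_cast hs
  have hq' : (2 : ℝ) ≤ q := by exact_mod_cast hq
  have hlt' : (p : ℝ) ≤ (q + 1) * s := by exact_mod_cast hlt.le
  have hp0 : (0 : ℝ) < p := by exact_mod_cast (by omega : 0 < p)
  have he : Real.exp 1 ≤ 3 := Real.exp_one_lt_three.le
  have hep := Real.exp_pos 1
  have : Real.log (Real.exp 1 * p / s) ≤ 4 * Real.log q := by
    rw [show (4 : ℝ) = ((4 : ℕ) : ℝ) by norm_num, ← Real.log_pow]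
    refine Real.log_le_log (by positivity) ?_
    rw [div_le_iff₀ hs0]
    have h8 : (8 : ℝ) ≤ q ^ 3 := by
      calc (8 : ℝ) = 2 ^ 3 := by norm_num
        _ ≤ q ^ 3 := by gcongr
    calc Real.exp 1 * p ≤ 3 * ((q + 1) * s) := by gcongr
      _ ≤ (8 * q) * s := by nlinarith
      _ ≤ (q ^ 3 * q) * s := by gcongr
      _ = (q : ℝ) ^ 4 * s := by ring
  calc P p s = s * Real.log (Real.exp 1 * p / s) := rfl
    _ ≤ s * (4 * Real.log q) := by gcongr
    _ = _ := by ring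

/-- The vector with value `r` on the graph of `f`, for an embedding of the product. -/
noncomputable def graphVec {p s q : ℕ} (e : Fin s × Fin q ↪ Fin p) (r : ℝ) (f : Fin s → Fin q) :
    E p :=
  WithLp.toLp 2 fun j => if j ∈ Finset.univ.image (fun i => e (i, f i)) then r else 0

theorem graphVec_apply {p s q : ℕ} (e : Fin s × Fin q ↪ Fin p) (r : ℝ) (f : Fin s → Fin q)
    (j : Fin p) :
    graphVec e r f j = if j ∈ Finset.univ.image (fun i => e (i, f i)) then r else 0 := rfl

theorem graphVec_mem_signals {p s q : ℕ} (e : Fin s × Fin q ↪ Fin p) {r : ℝ} {M : ℝ≥0∞}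
    (hr : ENNReal.ofReal |r| ≤ M) (f : Fin s → Fin q) : graphVec e r f ∈ signals p s M := by
  constructor
  · calc _ ≤ (Finset.univ.image (fun i => e (i, f i))).card := by
          refine Finset.card_le_card fun j hj => ?_
          by_contra h
          exact (Finset.mem_filter.1 hj).2 (by rw [graphVec_apply, if_neg h])
      _ ≤ (Finset.univ : Finset (Fin s)).card := Finset.card_image_le
      _ = s := by simp
  · intro j
    rw [graphVec_apply]
    split_ifs
    · exact hr
    · simp

theorem norm_sq_graphVec_le {p s q : ℕ} (e : Fin s × Fin q ↪ Fin p) (r : ℝ)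
    (f : Fin s → Fin q) : ‖graphVec e r f‖ ^ 2 ≤ s * r ^ 2 := by
  rw [EuclideanSpace.norm_sq_eq]
  calc ∑ j, ‖graphVec e r f j‖ ^ 2
      = ∑ j ∈ Finset.univ.image (fun i => e (i, f i)), r ^ 2 := by
        rw [← Finset.sum_filter_add_sum_filter_not Finset.univ
          (· ∈ Finset.univ.image (fun i => e (i, f i))), Finset.sum_eq_zero (s := Finset.filter
            (fun j => ¬ j ∈ Finset.univ.image (fun i => e (i, f i))) Finset.univ), add_zero]
        · refine Finset.sum_congr (by ext; simp) fun j hj => ?_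
          rw [graphVec_apply, if_pos hj, Real.norm_eq_abs, sq_abs]
        · intro j hj
          rw [graphVec_apply, if_neg (Finset.mem_filter.1 hj).2]
          simp
    _ ≤ s * r ^ 2 := by
        rw [Finset.sum_const, nsmul_eq_mul]
        gcongr
        exact Finset.card_image_le.trans (by simp)

/-- Each block where the words differ contributes the coordinate chosen by `f`, where the other
vector vanishes. The coordinate chosen by `g` is not needed. -/
theorem le_norm_sq_graphVec_sub {p s q : ℕ} (e : Fin s × Fin q ↪ Fin p) (r : ℝ)
    (f g : Fin s → Fin q) :
    hammingDist f g * r ^ 2 ≤ ‖graphVec e r f - graphVec e r g‖ ^ 2 := by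
  rw [EuclideanSpace.norm_sq_eq]
  calc hammingDist f g * r ^ 2
      = ∑ i ∈ Finset.univ.filter (fun i => f i ≠ g i), r ^ 2 := by
        rw [Finset.sum_const, nsmul_eq_mul]; rfl
    _ = ∑ j ∈ (Finset.univ.filter (fun i => f i ≠ g i)).image (fun i => e (i, f i)), r ^ 2 := by
        rw [Finset.sum_image]
        intro a _ b _ h
        exact (Prod.mk.inj (e.injective h)).1
    _ ≤ ∑ j ∈ (Finset.univ.filter (fun i => f i ≠ g i)).image (fun i => e (i, f i)),
          ‖(graphVec e r f - graphVec e r g) j‖ ^ 2 := by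
        refine Finset.sum_le_sum fun j hj => ?_
        obtain ⟨i, hi, rfl⟩ := Finset.mem_image.1 hj
        have hi' : f i ≠ g i := (Finset.mem_filter.1 hi).2
        have h1 : e (i, f i) ∈ Finset.univ.image (fun i => e (i, f i)) :=
          Finset.mem_image.2 ⟨i, Finset.mem_univ _, rfl⟩
        have h2 : e (i, f i) ∉ Finset.univ.image (fun i => e (i, g i)) := by
          intro h
          obtain ⟨k, -, hk⟩ := Finset.mem_image.1 h
          obtain ⟨rfl, hk⟩ := Prod.mk.inj (e.injective hk)
          exact hi' hk.symm
        rw [PiLp.sub_apply, graphVec_apply, graphVec_apply, if_pos h1, if_neg h2]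
        simp
    _ ≤ _ := Finset.sum_le_sum_of_subset_of_nonneg (Finset.subset_univ _)
          fun _ _ _ => by positivity

/-- Packing of the sparse signals of amplitude `r`. -/
theorem exists_packing {p s : ℕ} (hs : 1 ≤ s) (hsp : 2 * s ≤ p) {M : ℝ≥0∞} {r : ℝ}
    (hr : ENNReal.ofReal |r| ≤ M) (hr0 : r ≠ 0) :
    ∃ C : Finset (E p), 2 ≤ C.card ∧ P p s ≤ 24 * Real.log C.card ∧
      (∀ β ∈ C, β ∈ signals p s M ∧ ‖β‖ ^ 2 ≤ s * r ^ 2) ∧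
      ∀ β ∈ C, ∀ γ ∈ C, β ≠ γ → s * r ^ 2 / 6 ≤ ‖β - γ‖ ^ 2 := by
  classical
  have hq : 2 ≤ p / s := (Nat.le_div_iff_mul_le (by omega)).2 hsp
  have hPl := P_le_mul_log_div hs hsp
  have hmul : s * (p / s) ≤ p := Nat.mul_div_le p s
  generalize p / s = q at *
  obtain ⟨C, hC, hcard⟩ := exists_code (s := s) hq
  obtain ⟨e⟩ : Nonempty (Fin s × Fin q ↪ Fin p) :=
    Function.Embedding.nonempty_of_card_le (by simpa using hmul)
  have hs0 : (0 : ℝ) < s := by exact_mod_cast hs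
  have hq1 : (1 : ℝ) < q := by exact_mod_cast (by omega : 1 < q)
  have hsep : ∀ f ∈ C, ∀ g ∈ C, f ≠ g →
      s * r ^ 2 / 6 ≤ ‖graphVec e r f - graphVec e r g‖ ^ 2 := by
    intro f hf g hg hfg
    refine le_trans ?_ (le_norm_sq_graphVec_sub e r f g)
    have h : (s : ℝ) ≤ 6 * hammingDist f g := by exact_mod_cast hC f hf g hg hfg
    nlinarith [sq_nonneg r]
  have hinj : Set.InjOn (graphVec e r) C := by
    intro f hf g hg h
    by_contra hfg
    have := hsep f hf g hg hfg
    rw [h, sub_self, norm_zero] at this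
    have h' : 0 < s * r ^ 2 / 6 := by positivity
    norm_num at this
    linarith
  have hcard' : (C.image (graphVec e r)).card = C.card := Finset.card_image_of_injOn hinj
  have hone : (1 : ℝ) < C.card :=
    (Real.one_lt_rpow hq1 (by positivity)).trans_le hcard
  refine ⟨C.image (graphVec e r), ?_, ?_, ?_, ?_⟩
  · rw [hcard']; exact_mod_cast hone
  · rw [hcard']
    have := Real.log_le_log (by positivity) hcard
    rw [Real.log_rpow (by positivity)] at this
    linarith
  · intro β hβ
    obtain ⟨f, -, rfl⟩ := Finset.mem_image.1 hβ
    exact ⟨graphVec_mem_signals e hr f, norm_sq_graphVec_le e r f⟩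
  · intro β hβ γ hγ h
    obtain ⟨f, hf, rfl⟩ := Finset.mem_image.1 hβ
    obtain ⟨g, hg, rfl⟩ := Finset.mem_image.1 hγ
    exact hsep f hf g hg fun hfg => h (by rw [hfg])

end Packing

end SparseGLM

namespace SparseGLM

/-! ### Divergence and Fano's bound in exponential families -/

section ExponentialFamily

variable {n : ℕ} {ν : Measure (E n)} {σ : ℝ}

theorem measurable_exp_inner_div (σ : ℝ) (η : E n) :
    Measurable fun y : E n => ENNReal.ofReal (Real.exp (inner ℝ y η / σ ^ 2)) := by
  fun_prop

theorem normalizer_pos (hν : ν ≠ 0) (η : E n) : 0 < normalizer ν σ η := by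
  rw [normalizer, lintegral_pos_iff_support (measurable_exp_inner_div σ η)]
  have : (Function.support fun y : E n => ENNReal.ofReal (Real.exp (inner ℝ y η / σ ^ 2)))
      = Set.univ := by
    ext y
    simp [Real.exp_pos]
  rw [this]
  exact Measure.measure_univ_pos.2 hν

theorem normalizer_toReal_pos (h : IsRegular ν σ) {η : E n} (hη : η ∈ Ω ν σ) :
    0 < (normalizer ν σ η).toReal :=
  ENNReal.toReal_pos (normalizer_pos h.base_ne_zero η).ne' (ne_of_lt hη)

theorem exp_cumulant_div (h : IsRegular ν σ) {η : E n} (hη : η ∈ Ω ν σ) :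
    Real.exp (cumulant ν σ η / σ ^ 2) = (normalizer ν σ η).toReal := by
  have := h.scale_pos
  rw [cumulant, mul_div_cancel_left₀ _ (by positivity), Real.exp_log (normalizer_toReal_pos h hη)]

/-- Exponential tilting stays in the family, so total mass, integrability and moment generating
functions all reduce to the normalizer. -/
theorem lintegral_exp_inner_law (η h : E n) :
    ∫⁻ y, ENNReal.ofReal (Real.exp (inner ℝ y h / σ ^ 2)) ∂(law ν σ η)
      = ENNReal.ofReal (Real.exp (-(cumulant ν σ η / σ ^ 2))) * normalizer ν σ (η + h) := by
  rw [law, lintegral_withDensity_eq_lintegral_mul _ (by fun_prop)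
    (measurable_exp_inner_div σ h), normalizer, ← lintegral_const_mul _
    (measurable_exp_inner_div σ (η + h))]
  congr 1
  ext y
  rw [Pi.mul_apply, ← ENNReal.ofReal_mul (Real.exp_pos _).le, ← ENNReal.ofReal_mul
    (Real.exp_pos _).le, ← Real.exp_add, ← Real.exp_add, inner_add_right]
  congr 2
  ring

theorem isProbabilityMeasure_law (h : IsRegular ν σ) {η : E n} (hη : η ∈ Ω ν σ) :
    IsProbabilityMeasure (law ν σ η) := by
  constructor
  have := lintegral_exp_inner_law (ν := ν) (σ := σ) η 0
  simp only [inner_zero_right, zero_div, Real.exp_zero, ENNReal.ofReal_one, lintegral_const,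
    one_mul, add_zero] at this
  rw [this, ← ENNReal.ofReal_toReal (ne_of_lt hη), ← exp_cumulant_div h hη,
    ← ENNReal.ofReal_mul (Real.exp_pos _).le, ← Real.exp_add]
  simp

theorem integrable_exp_inner_law {η h : E n} (hη : η + h ∈ Ω ν σ) :
    Integrable (fun y => Real.exp (inner ℝ y h / σ ^ 2)) (law ν σ η) := by
  refine ⟨by fun_prop, ?_⟩
  rw [hasFiniteIntegral_iff_ofReal (Eventually.of_forall fun _ => (Real.exp_pos _).le),
    lintegral_exp_inner_law]
  exact ENNReal.mul_lt_top ENNReal.ofReal_lt_top hη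

theorem eventually_add_smul_mem_Ω (h : IsRegular ν σ) {η : E n} (hη : η ∈ Ω ν σ) (v : E n) :
    ∀ᶠ t : ℝ in 𝓝 0, η + t • v ∈ Ω ν σ := by
  have hc : Continuous fun t : ℝ => η + t • v := by fun_prop
  exact hc.continuousAt.eventually_mem (by simpa using h.dom_open.mem_nhds hη)

/-- This is where openness of `Ω` gives moments and differentiability of the cumulant. -/
theorem zero_mem_interior_integrableExpSet (h : IsRegular ν σ) {η : E n} (hη : η ∈ Ω ν σ)
    (v : E n) :
    (0 : ℝ) ∈ interior (ProbabilityTheory.integrableExpSet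
      (fun y : E n => inner ℝ y v / σ ^ 2) (law ν σ η)) := by
  rw [mem_interior_iff_mem_nhds]
  filter_upwards [eventually_add_smul_mem_Ω h hη v] with t ht
  have := integrable_exp_inner_law ht
  simp only [inner_smul_right, mul_div_assoc] at this
  exact this

theorem integrable_inner_law (h : IsRegular ν σ) {η : E n} (hη : η ∈ Ω ν σ) (v : E n) :
    Integrable (fun y => inner ℝ y v / σ ^ 2) (law ν σ η) := by
  simpa using ProbabilityTheory.integrable_pow_of_mem_interior_integrableExpSet
    (zero_mem_interior_integrableExpSet h hη v) 1

theorem cgf_law (h : IsRegular ν σ) {η v : E n} {t : ℝ}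
    (ht : η + t • v ∈ Ω ν σ) :
    ProbabilityTheory.cgf (fun y : E n => inner ℝ y v / σ ^ 2) (law ν σ η) t
      = (cumulant ν σ (η + t • v) - cumulant ν σ η) / σ ^ 2 := by
  have hmgf : ProbabilityTheory.mgf (fun y : E n => inner ℝ y v / σ ^ 2) (law ν σ η) t
      = Real.exp ((cumulant ν σ (η + t • v) - cumulant ν σ η) / σ ^ 2) := by
    have h1 := lintegral_exp_inner_law (ν := ν) (σ := σ) η (t • v)
    simp only [inner_smul_right, mul_div_assoc] at h1
    rw [ProbabilityTheory.mgf, integral_eq_lintegral_of_nonneg_ae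
      (Eventually.of_forall fun _ => (Real.exp_pos _).le) (by fun_prop), h1, ENNReal.toReal_mul,
      ENNReal.toReal_ofReal (Real.exp_pos _).le, ← exp_cumulant_div h ht, ← Real.exp_add]
    congr 1
    ring
  rw [ProbabilityTheory.cgf, hmgf, Real.log_exp]

/-- The increment of the loss at `y = 0` along `v` is a cumulant generating function, whose
derivative at `0` is the mean. -/
theorem dirDeriv_loss_zero (h : IsRegular ν σ) {η : E n} (hη : η ∈ Ω ν σ) (v : E n) :
    dirDeriv (loss ν σ 0) η v = ∫ y, inner ℝ y v / σ ^ 2 ∂(law ν σ η) := by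
  have := isProbabilityMeasure_law h hη
  have hint := zero_mem_interior_integrableExpSet h hη v
  have hd := (ProbabilityTheory.analyticAt_cgf hint).differentiableAt.hasDerivAt
  rw [ProbabilityTheory.deriv_cgf_zero hint] at hd
  have ht := hd.tendsto_slope_zero_right
  simp only [probReal_univ, div_one, zero_add] at ht
  refine Tendsto.limUnder_eq (ht.congr' ?_)
  filter_upwards [(eventually_add_smul_mem_Ω h hη v).filter_mono nhdsWithin_le_nhds] with t ht
  rw [cgf_law h ht, ProbabilityTheory.cgf_zero, loss, loss, smul_eq_mul]
  simp only [inner_zero_left]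
  ring

/-- The generalized Bregman function of the loss is the mean log-likelihood ratio. -/
theorem integral_logRatio_law (h : IsRegular ν σ) {η : E n} (hη : η ∈ Ω ν σ) :
    ∫ y, (inner ℝ y η - cumulant ν σ η + cumulant ν σ 0) / σ ^ 2 ∂(law ν σ η)
      = gbf (loss ν σ 0) 0 η := by
  have := isProbabilityMeasure_law h hη
  rw [gbf, dirDeriv_loss_zero h hη, zero_sub]
  have h1 : ∀ y : E n, (inner ℝ y η - cumulant ν σ η + cumulant ν σ 0) / σ ^ 2
      = inner ℝ y η / σ ^ 2 + (cumulant ν σ 0 - cumulant ν σ η) / σ ^ 2 := fun y => by ring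
  simp_rw [h1, inner_neg_right, neg_div]
  rw [integral_add (integrable_inner_law h hη η) (integrable_const _), integral_neg,
    integral_const, probReal_univ, loss, loss]
  simp only [inner_zero_left, one_smul]
  ring

theorem law_zero_eq_withDensity (η : E n) :
    law ν σ 0 = (law ν σ η).withDensity fun y =>
      ENNReal.ofReal (Real.exp (-((inner ℝ y η - cumulant ν σ η + cumulant ν σ 0) / σ ^ 2))) := by
  rw [law, law, ← withDensity_mul _ (by fun_prop) (by fun_prop)]
  congr 1
  ext y
  rw [Pi.mul_apply, ← ENNReal.ofReal_mul (Real.exp_pos _).le, ← Real.exp_add, inner_zero_right]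
  congr 2
  ring

/-- Gibbs variational inequality for an event. -/
theorem mul_law_real_le (h : IsRegular ν σ) {η : E n} (hη : η ∈ Ω ν σ)
    (h0 : (0 : E n) ∈ Ω ν σ) {A : Set (E n)} (hA : MeasurableSet A) (a : ℝ) :
    a * (law ν σ η).real A
      ≤ gbf (loss ν σ 0) 0 η + Real.log (1 + (Real.exp a - 1) * (law ν σ 0).real A) := by
  have := isProbabilityMeasure_law h hη
  have := isProbabilityMeasure_law h h0
  set R : E n → ℝ := fun y => (inner ℝ y η - cumulant ν σ η + cumulant ν σ 0) / σ ^ 2 with hR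
  have hRi : Integrable R (law ν σ η) := by
    have := (integrable_inner_law h hη η).add
      (integrable_const ((cumulant ν σ 0 - cumulant ν σ η) / σ ^ 2))
    refine this.congr (Eventually.of_forall fun y => ?_)
    simp only [hR, Pi.add_apply]
    ring
  have hind : Integrable (A.indicator fun _ => a) (law ν σ η) :=
    (integrable_const a).indicator hA
  have hg0 : Integrable (fun y => Real.exp (A.indicator (fun _ => a) y)) (law ν σ 0) := by
    have : (fun y => Real.exp (A.indicator (fun _ => a) y))
        = fun y => 1 + A.indicator (fun _ => Real.exp a - 1) y := by
      ext y
      by_cases hy : y ∈ A <;> simp [hy]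
    rw [this]
    exact (integrable_const _).add ((integrable_const _).indicator hA)
  have hval : ∫ y, Real.exp (A.indicator (fun _ => a) y) ∂(law ν σ 0)
      = 1 + (Real.exp a - 1) * (law ν σ 0).real A := by
    have : (fun y => Real.exp (A.indicator (fun _ => a) y))
        = fun y => 1 + A.indicator (fun _ => Real.exp a - 1) y := by
      ext y
      by_cases hy : y ∈ A <;> simp [hy]
    rw [this, integral_add (integrable_const _) ((integrable_const _).indicator hA),
      integral_indicator hA, integral_const, setIntegral_const, probReal_univ]
    simp [mul_comm]
  have hmeasR : Measurable fun y : E n => Real.exp (-(R y)) := by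
    simp only [hR]; fun_prop
  have hdens : ∀ y : E n, Real.exp (-(R y)) • Real.exp (A.indicator (fun _ => a) y)
      = Real.exp (A.indicator (fun _ => a) y - R y) := by
    intro y
    rw [smul_eq_mul, ← Real.exp_add]
    congr 1
    ring
  have hgi : Integrable (fun y => Real.exp (A.indicator (fun _ => a) y - R y)) (law ν σ η) := by
    rw [law_zero_eq_withDensity η, integrable_withDensity_iff_integrable_smul'
      hmeasR.ennreal_ofReal (Eventually.of_forall fun _ => ENNReal.ofReal_lt_top)] at hg0
    refine hg0.congr (Eventually.of_forall fun y => ?_)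
    simp only
    rw [ENNReal.toReal_ofReal (Real.exp_pos _).le]
    exact hdens y
  have heq : ∫ y, Real.exp (A.indicator (fun _ => a) y - R y) ∂(law ν σ η)
      = 1 + (Real.exp a - 1) * (law ν σ 0).real A := by
    rw [← hval, law_zero_eq_withDensity η, integral_withDensity_eq_integral_toReal_smul
      hmeasR.ennreal_ofReal (Eventually.of_forall fun _ => ENNReal.ofReal_lt_top)]
    refine integral_congr_ae (Eventually.of_forall fun y => ?_)
    simp only
    rw [ENNReal.toReal_ofReal (Real.exp_pos _).le]
    exact (hdens y).symm
  -- `R` is the log-likelihood ratio against the law at `0`. Jensen is applied to `a 1_A - R`, whose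
  -- exponential has under `η` the mean of `exp (a 1_A)` under `0`.
  have hjensen := convexOn_exp.map_integral_le Real.continuous_exp.continuousOn isClosed_univ
    (Eventually.of_forall fun y => Set.mem_univ (A.indicator (fun _ => a) y - R y))
    (hind.sub hRi) hgi
  rw [heq, integral_sub hind hRi, integral_indicator hA, setIntegral_const, smul_eq_mul,
    integral_logRatio_law h hη] at hjensen
  have := Real.log_le_log (Real.exp_pos _) hjensen
  rw [Real.log_exp] at this
  linarith

/-- Fano-type bound: events that are pairwise disjoint cannot all be likely under laws close
to the law of parameter `0`. -/
theorem exists_law_real_le (h : IsRegular ν σ) (h0 : (0 : E n) ∈ Ω ν σ) {ι : Type*}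
    {C : Finset ι} (hC : 2 ≤ C.card) (η : ι → E n) (hη : ∀ i ∈ C, η i ∈ Ω ν σ)
    (hK : ∀ i ∈ C, gbf (loss ν σ 0) 0 (η i) ≤ Real.log C.card / 4)
    {A : ι → Set (E n)} (hA : ∀ i ∈ C, MeasurableSet (A i))
    (hdisj : (C : Set ι).PairwiseDisjoint A) :
    ∃ i ∈ C, (law ν σ (η i)).real (A i) ≤ 11 / 12 := by
  have := isProbabilityMeasure_law h h0
  have hN : (2 : ℝ) ≤ C.card := by exact_mod_cast hC
  have hsum : ∑ i ∈ C, (law ν σ 0).real (A i) ≤ 1 := by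
    rw [← measureReal_biUnion_finset hdisj hA]
    exact measureReal_le_one
  -- Disjointness forces some event to have at most average probability under the reference law.
  obtain ⟨i, hi, hle⟩ : ∃ i ∈ C, (law ν σ 0).real (A i) ≤ (C.card : ℝ)⁻¹ := by
    refine Finset.exists_le_of_sum_le (Finset.card_pos.1 (by omega)) (hsum.trans ?_)
    rw [Finset.sum_const, nsmul_eq_mul, mul_inv_cancel₀ (by positivity)]
  refine ⟨i, hi, ?_⟩
  have hlog : 0 < Real.log C.card := Real.log_pos (by linarith)
  have h1 := mul_law_real_le h (hη i hi) h0 (hA i hi) (Real.log C.card)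
  rw [Real.exp_log (by positivity)] at h1
  have h2 : Real.log (1 + ((C.card : ℝ) - 1) * (law ν σ 0).real (A i))
      ≤ 2 / 3 * Real.log C.card := by
    refine le_trans (Real.log_le_log ?_ ?_) (log_two_sub_inv_le hC)
    · have : 0 ≤ ((C.card : ℝ) - 1) * (law ν σ 0).real (A i) :=
        mul_nonneg (by linarith) measureReal_nonneg
      linarith
    · calc 1 + ((C.card : ℝ) - 1) * (law ν σ 0).real (A i)
          ≤ 1 + ((C.card : ℝ) - 1) * (C.card : ℝ)⁻¹ := by
            gcongr
            linarith
        _ = 2 - (C.card : ℝ)⁻¹ := by field_simp; ring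
  have h3 := hK i hi
  -- `1 / 4 + 2 / 3 = 11 / 12`, after division by the log-cardinality.
  refine le_of_mul_le_mul_left (a := Real.log C.card) ?_ hlog
  linarith

end ExponentialFamily

end SparseGLM

namespace SparseGLM

/-! ### Minimax lower bounds -/

section LowerBound

theorem D2_eq {n : ℕ} (β γ : E n) : (D2 β γ : ℝ) = ‖β - γ‖ ^ 2 / 2 := by
  simp [D2]

theorem measurable_lin {n p : ℕ} (X : Matrix (Fin n) (Fin p) ℝ) : Measurable (lin X) :=
  (by unfold lin; fun_prop : Continuous (lin X)).measurable

theorem lin_zero {n p : ℕ} (X : Matrix (Fin n) (Fin p) ℝ) : lin X 0 = 0 := by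
  simp [lin]

theorem zero_mem_signals (p s : ℕ) (M : ℝ≥0∞) : (0 : E p) ∈ signals p s M := by
  simp [signals]

section Rate

variable {p s : ℕ} {σ : ℝ} {M : ℝ≥0∞} {κ : ℝ≥0}

theorem rateEst_pos (hs : 1 ≤ s) (hsp : 2 * s ≤ p) (hσ : 0 < σ) (hM : 0 < M) :
    0 < rateEst p s σ M κ := by
  have hP := P_pos hs hsp
  refine lt_min (ENNReal.div_pos (by positivity) ENNReal.coe_ne_top) ?_
  have : (0 : ℝ≥0∞) < s := by exact_mod_cast hs
  exact ENNReal.mul_pos (by positivity) this.ne'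

theorem rateEst_lt_top (hκ : 0 < κ ∨ M < ∞) : rateEst p s σ M κ < ∞ := by
  rcases hκ with hκ | hM
  · refine (min_le_left _ _).trans_lt (ENNReal.div_lt_top ENNReal.ofReal_ne_top ?_)
    exact_mod_cast hκ.ne'
  · exact (min_le_right _ _).trans_lt
      (ENNReal.mul_lt_top (ENNReal.pow_lt_top hM) (ENNReal.natCast_lt_top s))

theorem mul_rateEst_toReal_le (hs : 1 ≤ s) (hsp : 2 * s ≤ p) :
    κ * (rateEst p s σ M κ).toReal ≤ σ ^ 2 * P p s := by
  have hP := P_pos hs hsp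
  have h : (κ : ℝ≥0∞) * rateEst p s σ M κ ≤ ENNReal.ofReal (σ ^ 2 * P p s) := by
    calc (κ : ℝ≥0∞) * rateEst p s σ M κ
        ≤ κ * (ENNReal.ofReal (σ ^ 2 * P p s) / κ) := by
          gcongr
          exact min_le_left _ _
      _ ≤ _ := ENNReal.mul_div_le
  have := ENNReal.toReal_mono ENNReal.ofReal_ne_top h
  rwa [ENNReal.toReal_mul, ENNReal.coe_toReal, ENNReal.toReal_ofReal (by positivity)] at this

theorem rateEst_toReal_le {m : ℝ≥0} :
    (rateEst p s σ m κ).toReal ≤ m ^ 2 * s := by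
  have h : rateEst p s σ m κ ≤ ((m ^ 2 * s : ℝ≥0) : ℝ≥0∞) := by
    push_cast
    exact min_le_right _ _
  simpa using ENNReal.toReal_mono ENNReal.coe_ne_top h

/-- This lets a single bound, with an expansion factor `κ₁`, cover both rates. -/
theorem ratePred_eq_mul_rateEst (κ₁ : ℝ≥0) :
    ratePred p s σ M κ₁ κ = κ₁ * rateEst p s σ M κ := by
  rw [ratePred, rateEst, mul_min, mul_assoc, ENNReal.div_eq_inv_mul, ENNReal.div_eq_inv_mul]
  congr 1
  ring

end Rate

/-- Minimax lower bound for the loss transported by a map `T` that expands distances between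
signals. -/
theorem le_minimaxRisk {I : ℝ≥0 → ℝ≥0} (hI : Monotone I) {t : ℝ≥0} (ht : 0 < t)
    {n p s m : ℕ} {M : ℝ≥0∞} {ν : Measure (E n)} {σ : ℝ} {X : Matrix (Fin n) (Fin p) ℝ}
    {κ₁ κ : ℝ≥0} (hs : 1 ≤ s) (hsp : 2 * s ≤ p) (hM : 0 < M) (hκ₁ : 0 < κ₁)
    (hκ : 0 < κ ∨ M < ∞) (hreg : IsRegular ν σ) (hup : UpperCond ν σ X s M κ)
    {T : E p → E m} (hT : Measurable T)
    (hlow : ∀ β₁ ∈ signals p s M, ∀ β₂ ∈ signals p s M, κ₁ * D2 β₁ β₂ ≤ D2 (T β₁) (T β₂)) :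
    ((I t / 12 : ℝ≥0) : ℝ≥0∞) ≤ minimaxRisk ν σ X s M fun β β' =>
      I (D2 (T β) (T β') / ((2304 * t)⁻¹ * (κ₁ * rateEst p s σ M κ).toNNReal)) := by
  have hσ := hreg.scale_pos
  have hs0 : (0 : ℝ) < s := by exact_mod_cast hs
  have hR0 := rateEst_pos (κ := κ) hs hsp hσ hM
  have hRtop := rateEst_lt_top (p := p) (s := s) (σ := σ) hκ
  set R : ℝ := (rateEst p s σ M κ).toReal with hR
  have hRpos : 0 < R := ENNReal.toReal_pos hR0.ne' hRtop.ne
  have hRP : κ * R ≤ σ ^ 2 * P p s := mul_rateEst_toReal_le hs hsp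
  have hκ₁' : (0 : ℝ) < κ₁ := by exact_mod_cast hκ₁
  have hδ : (((κ₁ : ℝ≥0∞) * rateEst p s σ M κ).toNNReal : ℝ) = κ₁ * R := by
    rw [ENNReal.coe_toNNReal_eq_toReal, ENNReal.toReal_mul, ENNReal.coe_toReal]
  -- With `s * r ^ 2 = R / 48`, the divergence is at most `P / 96`, and `P ≤ 24 log |C|` turns this
  -- into `log |C| / 4`.
  set r : ℝ := √(R / (48 * s)) with hr
  have hrpos : 0 < r := Real.sqrt_pos.2 (by positivity)
  have hr2 : s * r ^ 2 = R / 48 := by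
    rw [hr, Real.sq_sqrt (by positivity)]
    field_simp
  have hrM : ENNReal.ofReal |r| ≤ M := by
    induction M with
    | top => exact le_top
    | coe M =>
      have hRM : R ≤ M ^ 2 * s := rateEst_toReal_le
      rw [abs_of_pos hrpos, ENNReal.ofReal_le_iff_le_toReal ENNReal.coe_ne_top,
        ENNReal.coe_toReal]
      refine Real.sqrt_le_iff.2 ⟨M.2, ?_⟩
      rw [div_le_iff₀ (by positivity)]
      nlinarith [mul_nonneg (sq_nonneg (M : ℝ)) hs0.le]
  obtain ⟨C, hC2, hCP, hC, hsep⟩ := exists_packing hs hsp hrM hrpos.ne'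
  have h0 : (0 : E n) ∈ Ω ν σ := by
    have := (hup 0 (zero_mem_signals p s M)).1
    rwa [lin_zero] at this
  refine le_iInf₂ fun est hest => ?_
  -- `2304 = 4 * 576`: distinct signals have `D2` at least `κ₁ R / (2 * 6 * 48)` after `T`, and the
  -- triangle inequality for squared norms loses a factor `4` when both radii are equal.
  set A : E p → Set (E n) := fun β =>
    {y | (D2 (T β) (T (est y)) : ℝ) < κ₁ * R / 2304} with hAdef
  have hA : ∀ β ∈ C, MeasurableSet (A β) := by
    intro β _
    have : Measurable fun y => (D2 (T β) (T (est y)) : ℝ) := by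
      simp only [D2_eq]
      have := hT.comp hest
      exact (((measurable_const.sub this).norm).pow_const 2).div_const 2
    exact measurableSet_lt this measurable_const
  have hdisj : (C : Set (E p)).PairwiseDisjoint A := by
    intro β hβ γ hγ hne
    refine Set.disjoint_left.2 fun y hy hy' => ?_
    have hy1 : (D2 (T β) (T (est y)) : ℝ) < κ₁ * R / 2304 := hy
    have hy2 : (D2 (T γ) (T (est y)) : ℝ) < κ₁ * R / 2304 := hy'
    have h1 : (κ₁ * D2 β γ : ℝ) ≤ D2 (T β) (T γ) := by
      exact_mod_cast hlow β (hC β hβ).1 γ (hC γ hγ).1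
    have h2 := hsep β hβ γ hγ hne
    rw [hr2] at h2
    rw [D2_eq] at hy1 hy2 h1
    rw [D2_eq] at h1
    have h3 : ‖T β - T γ‖ ≤ ‖T β - T (est y)‖ + ‖T γ - T (est y)‖ := by
      rw [norm_sub_rev (T γ)]
      exact norm_sub_le_norm_sub_add_norm_sub _ _ _
    have h4 : ‖T β - T γ‖ ^ 2 ≤ 2 * ‖T β - T (est y)‖ ^ 2 + 2 * ‖T γ - T (est y)‖ ^ 2 := by
      calc ‖T β - T γ‖ ^ 2 ≤ (‖T β - T (est y)‖ + ‖T γ - T (est y)‖) ^ 2 := by gcongr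
        _ ≤ _ := by nlinarith [sq_nonneg (‖T β - T (est y)‖ - ‖T γ - T (est y)‖)]
    have h5 : (κ₁ : ℝ) * (R / 48 / 6) ≤ κ₁ * ‖β - γ‖ ^ 2 := by gcongr
    linarith
  obtain ⟨β, hβ, hle⟩ := exists_law_real_le hreg h0 hC2 (lin X)
    (fun β hβ => (hup β (hC β hβ).1).1) (fun β hβ => by
      have h1 := (hup β (hC β hβ).1).2 0
      rw [D2_eq, zero_sub, norm_neg] at h1
      have h2 := (hC β hβ).2
      rw [hr2] at h2
      have h3 : (κ : ℝ) * (‖β‖ ^ 2 / 2) ≤ κ * (R / 48 / 2) := by gcongr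
      have h4 : σ ^ 2 * P p s ≤ σ ^ 2 * (24 * Real.log C.card) := by gcongr
      refine le_of_mul_le_mul_right (a := σ ^ 2) ?_ (by positivity)
      linarith) hA hdisj
  have hprob := isProbabilityMeasure_law hreg (hup β (hC β hβ).1).1
  have hcompl : ((1 / 12 : ℝ≥0) : ℝ≥0∞) ≤ law ν σ (lin X β) (A β)ᶜ := by
    have h1 : (1 / 12 : ℝ) ≤ (law ν σ (lin X β)).real (A β)ᶜ := by
      rw [probReal_compl_eq_one_sub (hA β hβ)]
      linarith
    rw [← ofReal_measureReal, ENNReal.ofReal, ENNReal.coe_le_coe]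
    refine NNReal.coe_le_coe.1 (le_trans ?_ (Real.le_coe_toNNReal _))
    simpa using h1
  refine le_trans ?_ (le_iSup₂_of_le β (hC β hβ).1 le_rfl)
  calc ((I t / 12 : ℝ≥0) : ℝ≥0∞) = I t * ((1 / 12 : ℝ≥0) : ℝ≥0∞) := by
        rw [← ENNReal.coe_mul]
        congr 1
        ring
    _ ≤ I t * law ν σ (lin X β) (A β)ᶜ := by gcongr
    _ = ∫⁻ _ in (A β)ᶜ, (I t : ℝ≥0∞) ∂(law ν σ (lin X β)) := by rw [setLIntegral_const]
    -- Off `A β` the argument of `I` is at least `t`: the constant `(2304 * t)⁻¹` rescales the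
    -- radius `κ₁ R / 2304` to `t`.
    _ ≤ ∫⁻ y in (A β)ᶜ, (I (D2 (T β) (T (est y)) /
          ((2304 * t)⁻¹ * ((κ₁ : ℝ≥0∞) * rateEst p s σ M κ).toNNReal)) : ℝ≥0∞)
          ∂(law ν σ (lin X β)) := by
        refine setLIntegral_mono' (hA β hβ).compl fun y hy => ?_
        refine ENNReal.coe_le_coe.2 (hI ?_)
        have hy' : κ₁ * R / 2304 ≤ (D2 (T β) (T (est y)) : ℝ) := not_lt.1 hy
        have ht' : (0 : ℝ) < t := by exact_mod_cast ht
        rw [← NNReal.coe_le_coe, NNReal.coe_div, NNReal.coe_mul, hδ, NNReal.coe_inv,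
          NNReal.coe_mul, le_div_iff₀ (by positivity)]
        refine le_trans (le_of_eq ?_) hy'
        simp only [NNReal.coe_ofNat]
        field_simp
    _ ≤ _ := setLIntegral_le_lintegral _ _

end LowerBound

end SparseGLM

theorem theorem1 (I : ℝ≥0 → ℝ≥0) (hI : Monotone I) (hI0 : I 0 = 0) (hI1 : ∃ t, I t ≠ 0) :
    (∃ c c' : ℝ≥0, 0 < c ∧ 0 < c' ∧
      ∀ (n p s : ℕ) (M : ℝ≥0∞) (ν : Measure (SparseGLM.E n)) (σ : ℝ)
        (X : Matrix (Fin n) (Fin p) ℝ) (κ : ℝ≥0),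
        2 ≤ p → 1 ≤ s → 2 * s ≤ p → 0 < M → 0 < κ →
        SparseGLM.IsRegular ν σ →
        SparseGLM.UpperCond ν σ X s M κ →
        (c : ℝ≥0∞) ≤ SparseGLM.minimaxRisk ν σ X s M fun β β' =>
          I (SparseGLM.D2 β β' / (c' * (SparseGLM.rateEst p s σ M κ).toNNReal))) ∧
    (∃ c c' : ℝ≥0, 0 < c ∧ 0 < c' ∧
      ∀ (n p s : ℕ) (M : ℝ≥0∞) (ν : Measure (SparseGLM.E n)) (σ : ℝ)
        (X : Matrix (Fin n) (Fin p) ℝ) (κ₁ κ₂ : ℝ≥0),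
        2 ≤ p → 1 ≤ s → 2 * s ≤ p → 0 < M → 0 < κ₁ → (0 < κ₂ ∨ M < ∞) →
        SparseGLM.IsRegular ν σ →
        SparseGLM.LowerCond X s M κ₁ →
        SparseGLM.UpperCond ν σ X s M κ₂ →
        (c : ℝ≥0∞) ≤ SparseGLM.minimaxRisk ν σ X s M fun β β' =>
          I (SparseGLM.D2 (SparseGLM.lin X β) (SparseGLM.lin X β') /
            (c' * (SparseGLM.ratePred p s σ M κ₁ κ₂).toNNReal))) := by
  -- Any `t` with `I t ≠ 0` fixes both constants, which therefore depend on `I` alone; `I 0 = 0`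
  -- makes `t` positive.
  obtain ⟨t, hIt⟩ := hI1
  have ht : 0 < t := pos_iff_ne_zero.2 fun h => hIt (h ▸ hI0)
  have hIt' : 0 < I t / 12 := div_pos (pos_iff_ne_zero.2 hIt) (by norm_num)
  refine ⟨⟨I t / 12, (2304 * t)⁻¹, hIt', by positivity, ?_⟩,
    ⟨I t / 12, (2304 * t)⁻¹, hIt', by positivity, ?_⟩⟩
  · intro n p s M ν σ X κ _ hs hsp hM hκ hreg hup
    simpa using SparseGLM.le_minimaxRisk (κ₁ := 1) hI ht hs hsp hM one_pos (Or.inl hκ) hreg hup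
      measurable_id (fun β₁ _ β₂ _ => by simp)
  · intro n p s M ν σ X κ₁ κ₂ _ hs hsp hM hκ₁ hκ₂ hreg hlow hup
    rw [SparseGLM.ratePred_eq_mul_rateEst]
    exact SparseGLM.le_minimaxRisk hI ht hs hsp hM hκ₁ hκ₂ hreg hup
      (SparseGLM.measurable_lin X) hlow
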